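/- Let $F:\mathbb R^n\to\mathbb R^m$ be a single-valued mapping that is Lipschitz continuous on a neighbourhood of $\bar x\in\mathbb R^n$. Then the following two statements are equivalent. (i) $F$ is semismooth at $\bar x$ (in the sense of Mifflin and Qi–Sun), i.e. $F$ is Lipschitz near $\bar x$ and for every $u\in\mathbb R^n$ the limit $$\lim_{\substack{A\in\operatorname{co}\overline\nabla F(\bar x+tu')\\ u'\to u,\ t\downarrow 0}}Au'$$ exists. (ii) $F$ is semismooth$^*$ at $\bar x$, and for every $u\in\mathbb R^n$ the directional derivative $F'(\bar x;u)=\lim_{t\downarrow 0}\frac{F(\bar x+tu)-F(\bar x)}{t}$ exists. Here $\overline\nabla F(x)$ denotes the B-subdifferential, i.e. the set of all matrices $A=\lim_k\nabla F(u_k)$ with $u_k\to x$ and $F$ differentiable at each $u_k$; its convex hull $\operatorname{co}\overline\nabla F(x)$ is the Clarke generalized Jacobian. For a set $A\subseteq\mathbb R^s$ and $z\in A$, the tangent cone $T_A(z)$ consists of all $w$ for which there are $t_k\downarrow 0$ and $w_k\to w$ with $z+t_kw_k\in A$ for all $k$; the regular normal cone is $\widehat N_A(z)=\{z^*: \langle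 z^*,w\rangle\le 0\ \forall w\in T_A(z)\}$ for $z\in A$, and $\widehat N_A(z)=\emptyset$ for $z\notin A$. The directional limiting normal cone $N_A(\bar z;d)$ consists of all $z^*$ for which there are $t_k\downarrow 0$, $d_k\to d$, $z_k^*\to z^*$ with $z_k^*\in\widehat N_A(\bar z+t_kd_k)$ for all $k$. The set $A$ is semismooth$^*$ at $\bar z\in A$ if $\langle z^*,d\rangle=0$ for all $d\in\mathbb R^s$ and all $z^*\in N_A(\bar z;d)$. The mapping $F$ is semismooth$^*$ at $\bar x$ if its graph $\{(x,F(x)):x\in\mathbb R^n\}\subseteq\mathbb R^n\times\mathbb R^m$ is semismooth$^*$ at $(\bar x,F(\bar x))$. -/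

import Mathlib

open Filter Topology

namespace VarAnalysis

section Sets

variable {H : Type*} [NormedAddCommGroup H] [InnerProductSpace ℝ H]

/-- The tangent (contingent, Bouligand) cone `Limsup_{t ↘ 0} (A - x) / t`. -/
def tangentCone (A : Set H) (x : H) : Set H :=
  {w | ∃ (t : ℕ → ℝ) (d : ℕ → H), (∀ k, 0 < t k) ∧ Tendsto t atTop (𝓝 0) ∧
    Tendsto d atTop (𝓝 w) ∧ ∀ k, x + t k • d k ∈ A}

/-- The regular (Fréchet) normal cone: the negative polar of the tangent cone at points of `A`,
and the empty set at points outside `A`. -/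
def regularNormalCone (A : Set H) (x : H) : Set H :=
  {z | x ∈ A ∧ ∀ w ∈ tangentCone A x, inner ℝ z w ≤ 0}

/-- The directional limiting normal cone
`Limsup_{t ↘ 0, d' → d} (regularNormalCone A (x + t d'))`. -/
def dirLimitingNormalCone (A : Set H) (x d : H) : Set H :=
  {z | ∃ (t : ℕ → ℝ) (d' z' : ℕ → H), (∀ k, 0 < t k) ∧ Tendsto t atTop (𝓝 0) ∧
    Tendsto d' atTop (𝓝 d) ∧ Tendsto z' atTop (𝓝 z) ∧
    ∀ k, z' k ∈ regularNormalCone A (x + t k • d' k)}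

/-- Semismoothness* of a set `A` at `x`. -/
def SetSemismoothStarAt (A : Set H) (x : H) : Prop :=
  x ∈ A ∧ ∀ u : H, ∀ z ∈ dirLimitingNormalCone A x u, inner ℝ z u = 0

end Sets

section Maps

variable {E G : Type*} [NormedAddCommGroup E] [InnerProductSpace ℝ E]
  [NormedAddCommGroup G] [InnerProductSpace ℝ G]

/-- The graph of a set-valued mapping, in the product space with the Euclidean norm
`‖(x, y)‖ = √(‖x‖² + ‖y‖²)`. -/
def gph (F : E → Set G) : Set (WithLp 2 (E × G)) :=
  {p | p.snd ∈ F p.fst}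

/-- Semismoothness* of a set-valued mapping at a point `(x, y)` of its graph. -/
def SemismoothStarAt (F : E → Set G) (x : E) (y : G) : Prop :=
  SetSemismoothStarAt (gph F) (WithLp.toLp 2 (x, y))

/-- `F` is Lipschitz continuous on a neighbourhood of `x`. -/
def LipschitzNear (F : E → G) (x : E) : Prop :=
  ∃ K : NNReal, ∃ U ∈ 𝓝 x, LipschitzOnWith K F U

/-- The B-subdifferential: limits of derivatives at differentiability points tending to `x`. -/
def bSubdifferential (F : E → G) (x : E) : Set (E →L[ℝ] G) :=
  {A | ∃ u : ℕ → E, (∀ k, DifferentiableAt ℝ F (u k)) ∧ Tendsto u atTop (𝓝 x) ∧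
    Tendsto (fun k => fderiv ℝ F (u k)) atTop (𝓝 A)}

/-- The Clarke generalized Jacobian. -/
def clarkeJacobian (F : E → G) (x : E) : Set (E →L[ℝ] G) :=
  convexHull ℝ (bSubdifferential F x)

/-- Classical semismoothness of `F` at `x`: `F` is Lipschitz near `x` and, for every `u`, the limit
of `A u'` over `A ∈ clarkeJacobian F (x + t u')`, `u' → u`, `t ↓ 0` exists. -/
def SemismoothAt (F : E → G) (x : E) : Prop :=
  LipschitzNear F x ∧
    ∀ u : E, ∃ l : G, ∀ ε > 0, ∃ δ > 0, ∀ t : ℝ, 0 < t → t < δ → ∀ u' : E, ‖u' - u‖ < δ →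
      ∀ A ∈ clarkeJacobian F (x + t • u'), ‖A u' - l‖ < ε

/-- The one-sided directional derivative `F'(x; u)` exists for every direction `u`. -/
def DirectionallyDifferentiableAt (F : E → G) (x : E) : Prop :=
  ∀ u : E, ∃ l : G, Tendsto (fun t : ℝ => t⁻¹ • (F (x + t • u) - F x)) (𝓝[>] 0) (𝓝 l)

end Maps

end VarAnalysis

/-! Both sides say that `∇F(x + tu')u' → F'(x;u)` over differentiability points as `u' → u`, `t ↓
0`.

From semismoothness: near `x + tu'` every derivative sends `u'` close to `l`. By Rademacher and
Fubini this integrates along lines (`norm_sub_sub_smul_le_of_fderiv`). Hence `F'(x;u) = l`, and the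
graph at `x + tu'` has tangents close to `±(u', l)`. Regular normals there nearly annihilate `(u',
l)`, and limiting normals annihilate `(u, l)`.

Conversely, derivatives `A` yield graph normals `(A* w, -w)`. Their limits must annihilate `(u,
F'(x;u))` for every `w`, so limits of derivatives send `u` to `F'(x;u)`. Compactness makes this a
uniform estimate, and convexity carries it to the Clarke Jacobian. -/

namespace VarAnalysis

open MeasureTheory Set Metric

/-- Mean value inequality for Lipschitz curves whose derivative is almost everywhere close to a
fixed vector. -/
theorem norm_sub_sub_smul_le_of_ae_hasDerivAt {G : Type*} [NormedAddCommGroup G]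
    [InnerProductSpace ℝ G] {f : ℝ → G} {a b ε : ℝ} {K : NNReal} {l : G} (hε : 0 ≤ ε)
    (hab : a ≤ b)
    (hf : LipschitzOnWith K f (Icc a b))
    (hd : ∀ᵐ s, s ∈ Icc a b → ∃ f', HasDerivAt f f' s ∧ ‖f' - l‖ ≤ ε) :
    ‖f b - f a - (b - a) • l‖ ≤ ε * (b - a) := by
  -- Testing against the error itself reduces to the scalar fundamental theorem of calculus and
  -- gives `‖w‖² ≤ ‖w‖ ε (b - a)`.
  set w := f b - f a - (b - a) • l with hw
  have hlip : LipschitzOnWith (‖innerSL ℝ w‖₊ * K) (fun s => inner ℝ w (f s)) (uIcc a b) := by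
    rw [uIcc_of_le hab]
    exact (innerSL ℝ w).lipschitz.comp_lipschitzOnWith hf
  have hac := hlip.absolutelyContinuousOnInterval
  have hint := hac.intervalIntegrable_deriv
  have hmono : ∫ s in a..b, deriv (fun s => inner ℝ w (f s)) s
      ≤ ∫ _ in a..b, (inner ℝ w l + ‖w‖ * ε) := by
    refine intervalIntegral.integral_mono_ae_restrict hab hint intervalIntegrable_const ?_
    refine (ae_restrict_iff' measurableSet_Icc).2 ?_
    filter_upwards [hd] with s hs hsab
    obtain ⟨f', hf', hle⟩ := hs hsab
    have h1 : HasDerivAt (fun s => inner ℝ w (f s)) (inner ℝ w f') s :=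
      (innerSL ℝ w).hasFDerivAt.comp_hasDerivAt s hf'
    rw [h1.deriv]
    have h2 : inner ℝ w (f' - l) ≤ ‖w‖ * ε :=
      (real_inner_le_norm _ _).trans (mul_le_mul_of_nonneg_left hle (norm_nonneg _))
    rw [inner_sub_right] at h2
    linarith
  rw [hac.integral_deriv_eq_sub, intervalIntegral.integral_const, smul_eq_mul] at hmono
  have hww : ‖w‖ * ‖w‖ ≤ ‖w‖ * (ε * (b - a)) := by
    have : inner ℝ w w = inner ℝ w (f b) - inner ℝ w (f a) - (b - a) * inner ℝ w l := by
      conv_lhs => rw [hw, inner_sub_right, inner_sub_right, inner_smul_right]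
    rw [← real_inner_self_eq_norm_mul_norm, this]
    linarith
  rcases (norm_nonneg w).eq_or_lt with h0 | h0
  · rw [← h0]
    exact mul_nonneg hε (sub_nonneg.2 hab)
  · exact le_of_mul_le_mul_left hww h0

/-! ### Mean value inequality by Rademacher and Fubini -/

section MeanValue

variable {E G : Type*} [NormedAddCommGroup E] [InnerProductSpace ℝ E] [FiniteDimensional ℝ E]
  [NormedAddCommGroup G] [InnerProductSpace ℝ G]

/-- Fubini: for each fixed `s`, a translate of a null set is null. -/
theorem ae_ae_add_smul_of_ae [MeasurableSpace E] [BorelSpace E] {μ : Measure E}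
    [μ.IsAddHaarMeasure] {P : E → Prop} (hP : ∀ᵐ p ∂μ, P p) (v : E) :
    ∀ᵐ p ∂μ, ∀ᵐ s : ℝ, P (p + s • v) := by
  set N := toMeasurable μ {p | ¬ P p}
  have hN : μ N = 0 := by rw [measure_toMeasurable]; exact hP
  have hmeas : MeasurableSet {q : E × ℝ | q.1 + q.2 • v ∉ N} :=
    (measurableSet_toMeasurable _ _).compl.preimage (by fun_prop)
  have key : ∀ᵐ p ∂μ, ∀ᵐ s : ℝ, p + s • v ∉ N := by
    rw [Measure.ae_ae_comm hmeas]
    refine Eventually.of_forall fun s => ?_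
    have := (measurePreserving_add_right μ (s • v)).quasiMeasurePreserving.ae
      (p := fun p => p ∉ N) (by rw [ae_iff]; simpa using hN)
    exact this
  filter_upwards [key] with p hp
  filter_upwards [hp] with s hs
  by_contra hc
  exact hs (subset_toMeasurable _ _ hc)

variable [FiniteDimensional ℝ G]

/-- Mean value inequality along segments for a Lipschitz mapping whose derivatives, where they
exist, are close to `l` in the direction `v`. -/
theorem norm_sub_sub_smul_le_of_fderiv {F : E → G} {U : Set E} {K : NNReal} {v : E} {l : G}
    {ε : ℝ} (hε : 0 ≤ ε) (hU : IsOpen U) (hUc : Convex ℝ U) (hF : LipschitzOnWith K F U)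
    (hd : ∀ p ∈ U, DifferentiableAt ℝ F p → ‖fderiv ℝ F p v - l‖ ≤ ε)
    {p : E} {s : ℝ} (hs : 0 ≤ s) (hp : p ∈ U) (hps : p + s • v ∈ U) :
    ‖F (p + s • v) - F p - s • l‖ ≤ ε * s := by
  borelize E
  let μ : Measure E := Measure.addHaar
  have hrad : ∀ᵐ q ∂μ, q ∈ U → DifferentiableAt ℝ F q := by
    filter_upwards [hF.ae_differentiableWithinAt_of_mem (μ := μ)] with q hq hqU
    exact (hq hqU).differentiableAt (hU.mem_nhds hqU)
  have hae := ae_ae_add_smul_of_ae hrad v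
  have hgood : ∀ q : E, (∀ᵐ r : ℝ, q + r • v ∈ U → DifferentiableAt ℝ F (q + r • v)) → q ∈ U →
      q + s • v ∈ U → ‖F (q + s • v) - F q - s • l‖ ≤ ε * s := by
    intro q hq hqU hqs
    have hseg : ∀ r ∈ Icc 0 s, q + r • v ∈ U := by
      intro r hr
      rcases hs.eq_or_lt with rfl | hpos
      · obtain rfl : r = 0 := le_antisymm hr.2 hr.1
        exact hqs
      · have := hUc.add_smul_mem hqU hqs (t := r / s)
          ⟨div_nonneg hr.1 hs, div_le_one_of_le₀ hr.2 hs⟩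
        rwa [smul_smul, div_mul_cancel₀ _ hpos.ne'] at this
    have hlip : LipschitzOnWith (K * ‖v‖₊) (fun r : ℝ => F (q + r • v)) (Icc 0 s) := by
      have hline : LipschitzWith ‖v‖₊ fun r : ℝ => q + r • v :=
        LipschitzWith.of_dist_le_mul fun r r' => by
          rw [dist_add_left, dist_eq_norm, ← sub_smul, norm_smul, mul_comm, Real.dist_eq]
          simp
      exact hF.comp hline.lipschitzOnWith hseg
    have := norm_sub_sub_smul_le_of_ae_hasDerivAt (l := l) hε hs hlip (by
      filter_upwards [hq] with r hr hrs
      have hdiff := hr (hseg r hrs)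
      refine ⟨fderiv ℝ F (q + r • v) v, ?_, hd _ (hseg r hrs) hdiff⟩
      have h1 : HasDerivAt (fun r : ℝ => q + r • v) v r := by
        simpa using ((hasDerivAt_id r).smul_const v).const_add q
      exact hdiff.hasFDerivAt.comp_hasDerivAt r h1)
    simpa using this
  -- The line through `p` may be exceptional, but good base points are dense and `F` is continuous.
  have hdense : p ∈ closure {q : E | ∀ᵐ r : ℝ, q + r • v ∈ U → DifferentiableAt ℝ F (q + r • v)} :=
    Measure.dense_of_ae hae p
  obtain ⟨q, hq, hqp⟩ := mem_closure_iff_seq_limit.1 hdense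
  have hqps : Tendsto (fun k => q k + s • v) atTop (𝓝 (p + s • v)) := hqp.add_const _
  have hcont : ∀ z ∈ U, ContinuousAt F z := fun z hz =>
    hF.continuousOn.continuousAt (hU.mem_nhds hz)
  refine le_of_tendsto (((((hcont _ hps).tendsto.comp hqps).sub
    ((hcont _ hp).tendsto.comp hqp)).sub_const _).norm) ?_
  filter_upwards [hqp (hU.mem_nhds hp), hqps (hU.mem_nhds hps)] with k h1 h2
  exact hgood (q k) (hq k) h1 h2

end MeanValue

theorem LipschitzNear.exists_isOpen {E G : Type*} [NormedAddCommGroup E]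
    [NormedAddCommGroup G] {F : E → G} {x : E} (h : LipschitzNear F x) :
    ∃ K : NNReal, ∃ U : Set E, IsOpen U ∧ x ∈ U ∧ LipschitzOnWith K F U := by
  obtain ⟨K, U, hU, hK⟩ := h
  obtain ⟨V, hVU, hV, hxV⟩ := _root_.mem_nhds_iff.1 hU
  exact ⟨K, V, hV, hxV, hK.mono hVU⟩

/-! ### Derivatives, difference quotients and the Clarke Jacobian -/

section

variable {E G : Type*} [NormedAddCommGroup E] [InnerProductSpace ℝ E]
  [NormedAddCommGroup G] [InnerProductSpace ℝ G] {F : E → G} {x u : E} {l : G}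

theorem fderiv_mem_clarkeJacobian (h : DifferentiableAt ℝ F x) :
    fderiv ℝ F x ∈ clarkeJacobian F x :=
  subset_convexHull ℝ _ ⟨fun _ => x, fun _ => h, tendsto_const_nhds, tendsto_const_nhds⟩

theorem exists_pos_forall_add_smul_mem {U : Set E} (hU : U ∈ 𝓝 x) (u : E) :
    ∃ δ > 0, ∀ t : ℝ, 0 < t → t < δ → ∀ u' : E, ‖u' - u‖ < δ → x + t • u' ∈ U := by
  have hc : ContinuousAt (fun q : ℝ × E => x + q.1 • q.2) (0, u) := by fun_prop
  have := hc.preimage_mem_nhds (t := U) (by simpa using hU)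
  obtain ⟨δ, hδ, hsub⟩ := Metric.mem_nhds_iff.1 this
  refine ⟨δ, hδ, fun t ht htδ u' hu' => hsub (a := (t, u')) ?_⟩
  rw [Metric.mem_ball, Prod.dist_eq, max_lt_iff]
  exact ⟨by simpa [abs_of_pos ht] using htδ, by simpa [dist_eq_norm] using hu'⟩

/-- Under the semismoothness estimate in the direction `u`, derivatives of `F` at points close to
`x + t u'` nearly map `u'` to the limit `l`. -/
theorem exists_ball_norm_fderiv_sub_le (hF : LipschitzNear F x)
    (hl : ∀ ε > 0, ∃ δ > 0, ∀ t : ℝ, 0 < t → t < δ → ∀ u' : E, ‖u' - u‖ < δ →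
      ∀ A ∈ clarkeJacobian F (x + t • u'), ‖A u' - l‖ < ε) {ε : ℝ} (hε : 0 < ε) :
    ∃ δ > 0, ∀ t : ℝ, 0 < t → t < δ → ∀ u' : E, ‖u' - u‖ < δ →
      ∃ r > 0, ∃ K : NNReal, LipschitzOnWith K F (ball (x + t • u') r) ∧
        ∀ p ∈ ball (x + t • u') r, DifferentiableAt ℝ F p → ‖fderiv ℝ F p u' - l‖ ≤ ε := by
  obtain ⟨K, U, hU, hxU, hK⟩ := hF.exists_isOpen
  obtain ⟨δ₁, hδ₁, h₁⟩ := exists_pos_forall_add_smul_mem (hU.mem_nhds hxU) u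
  obtain ⟨δ₂, hδ₂, h₂⟩ := hl (ε / 2) (half_pos hε)
  refine ⟨min δ₁ δ₂, lt_min hδ₁ hδ₂, fun t ht htδ u' hu' => ?_⟩
  rw [lt_min_iff] at htδ hu'
  -- The hypothesis controls the derivative at `p` only in its own direction `(p - x) / t`;
  -- replacing that by `u'` costs at most `K` times their distance.
  have hcu : Tendsto (fun p => t⁻¹ • (p - x)) (𝓝 (x + t • u')) (𝓝 u') := by
    have : ContinuousAt (fun p => t⁻¹ • (p - x)) (x + t • u') := by fun_prop
    simpa [ContinuousAt, smul_smul, ht.ne'] using this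
  have e₁ : ∀ᶠ p in 𝓝 (x + t • u'), p ∈ U := hU.mem_nhds (h₁ t ht htδ.1 u' hu'.1)
  have e₂ : ∀ᶠ p in 𝓝 (x + t • u'), ‖t⁻¹ • (p - x) - u‖ < δ₂ :=
    (hcu.sub_const u).norm.eventually_lt_const hu'.2
  have e₃ : ∀ᶠ p in 𝓝 (x + t • u'), (K : ℝ) * ‖t⁻¹ • (p - x) - u'‖ < ε / 2 := by
    refine ((hcu.sub_const u').norm.const_mul (K : ℝ)).eventually_lt_const ?_
    simpa using half_pos hε
  obtain ⟨r, hr, hball⟩ := Metric.eventually_nhds_iff_ball.1 (e₁.and (e₂.and e₃))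
  refine ⟨r, hr, K, hK.mono fun p hp => (hball p hp).1, fun p hp hdiff => ?_⟩
  obtain ⟨hp₁, hp₂, hp₃⟩ := hball p hp
  have hx : x + t • t⁻¹ • (p - x) = p := by simp [smul_smul, ht.ne']
  have hclose := h₂ t ht htδ.2 _ hp₂ (fderiv ℝ F p) (by
    rw [hx]; exact fderiv_mem_clarkeJacobian hdiff)
  have hnorm : ‖fderiv ℝ F p‖ ≤ K := norm_fderiv_le_of_lipschitzOn ℝ (hU.mem_nhds hp₁) hK
  have hle : ‖fderiv ℝ F p (t⁻¹ • (p - x) - u')‖ < ε / 2 :=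
    ((fderiv ℝ F p).le_of_opNorm_le hnorm _).trans_lt hp₃
  have heq : fderiv ℝ F p u' - l =
      (fderiv ℝ F p (t⁻¹ • (p - x)) - l) - fderiv ℝ F p (t⁻¹ • (p - x) - u') := by
    rw [map_sub]; abel
  rw [heq]
  exact (norm_sub_le _ _).trans (by linarith)

/-- For Lipschitz mappings, directional derivatives are Hadamard directional derivatives. -/
theorem LipschitzNear.tendsto_slope_seq (hF : LipschitzNear F x)
    (hdir : Tendsto (fun t : ℝ => t⁻¹ • (F (x + t • u) - F x)) (𝓝[>] 0) (𝓝 l))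
    {t : ℕ → ℝ} {d : ℕ → E} (ht : ∀ k, 0 < t k) (ht0 : Tendsto t atTop (𝓝 0))
    (hd : Tendsto d atTop (𝓝 u)) :
    Tendsto (fun k => (t k)⁻¹ • (F (x + t k • d k) - F x)) atTop (𝓝 l) := by
  obtain ⟨K, U, hU, hxU, hK⟩ := hF.exists_isOpen
  have hfix := hdir.comp (tendsto_nhdsWithin_iff.2 ⟨ht0, Eventually.of_forall ht⟩)
  have hmem : ∀ {e : ℕ → E}, Tendsto e atTop (𝓝 u) → ∀ᶠ k in atTop, x + t k • e k ∈ U := by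
    intro e he
    have : Tendsto (fun k => x + t k • e k) atTop (𝓝 x) := by
      simpa using (ht0.smul he).const_add x
    exact this (hU.mem_nhds hxU)
  have hdiff : Tendsto (fun k => (t k)⁻¹ • (F (x + t k • d k) - F (x + t k • u))) atTop (𝓝 0) := by
    have hz : Tendsto (fun k => (K : ℝ) * ‖d k - u‖) atTop (𝓝 0) := by
      simpa using (hd.sub_const u).norm.const_mul (K : ℝ)
    refine squeeze_zero_norm' ?_ hz
    filter_upwards [hmem hd, hmem tendsto_const_nhds] with k h1 h2
    have := hK.norm_sub_le h1 h2
    rw [add_sub_add_left_eq_sub, ← smul_sub, norm_smul, Real.norm_of_nonneg (ht k).le] at this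
    rw [norm_smul, norm_inv, Real.norm_of_nonneg (ht k).le, inv_mul_le_iff₀ (ht k)]
    linarith
  have := hdiff.add hfix
  rw [zero_add] at this
  refine this.congr fun k => ?_
  simp only [Function.comp, ← smul_add, sub_add_sub_cancel]

/-- An estimate at all differentiability points in a conic neighbourhood passes to the Clarke
generalized Jacobian. -/
theorem norm_clarkeJacobian_sub_le {u : E} {l : G} {ε δ : ℝ}
    (h : ∀ t : ℝ, 0 < t → t < δ → ∀ u' : E, ‖u' - u‖ < δ →
      DifferentiableAt ℝ F (x + t • u') → ‖fderiv ℝ F (x + t • u') u' - l‖ < ε)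
    {t : ℝ} (ht : 0 < t) (htδ : t < δ) {u' : E} (hu' : ‖u' - u‖ < δ) {A : E →L[ℝ] G}
    (hA : A ∈ clarkeJacobian F (x + t • u')) : ‖A u' - l‖ ≤ ε := by
  have hconv : Convex ℝ {B : E →L[ℝ] G | B u' ∈ closedBall l ε} :=
    (convex_closedBall l ε).is_linear_preimage
      (f := fun B : E →L[ℝ] G => B u') ⟨fun _ _ => rfl, fun _ _ => rfl⟩
  suffices hsub : bSubdifferential F (x + t • u') ⊆ {B : E →L[ℝ] G | B u' ∈ closedBall l ε} by
    simpa [dist_eq_norm] using convexHull_min hsub hconv hA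
  rintro B ⟨y, hy, hyx, hyB⟩
  -- Each `y k` is rewritten as `x + t • u''` with the same `t` and `u'' → u'`, so that `h` applies
  -- to it.
  have hd : Tendsto (fun k => t⁻¹ • (y k - x)) atTop (𝓝 u') := by
    simpa [smul_smul, ht.ne'] using (hyx.sub_const x).const_smul t⁻¹
  have heq : ∀ k, x + t • t⁻¹ • (y k - x) = y k := fun k => by simp [smul_smul, ht.ne']
  rw [mem_ofPred_eq, mem_closedBall, dist_eq_norm]
  refine le_of_tendsto (((isBoundedBilinearMap_apply.continuous.tendsto (B, u')).comp
    (hyB.prodMk_nhds hd)).sub_const l).norm ?_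
  filter_upwards [(hd.sub_const u).norm.eventually_lt_const hu'] with k hk
  have := h t ht htδ _ hk
  rw [heq] at this
  exact (this (hy k)).le

variable [FiniteDimensional ℝ E] [FiniteDimensional ℝ G]

/-- The radius of the ball on which derivatives are controlled depends on `t`, so local increments
are glued by a comparison argument on `[a, b]` with `a > 0`; then `a ↓ 0`. -/
theorem tendsto_slope_of_clarkeJacobian (hF : LipschitzNear F x)
    (hl : ∀ ε > 0, ∃ δ > 0, ∀ t : ℝ, 0 < t → t < δ → ∀ u' : E, ‖u' - u‖ < δ →
      ∀ A ∈ clarkeJacobian F (x + t • u'), ‖A u' - l‖ < ε) :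
    Tendsto (fun t : ℝ => t⁻¹ • (F (x + t • u) - F x)) (𝓝[>] 0) (𝓝 l) := by
  obtain ⟨K, U, hU, hxU, hK⟩ := hF.exists_isOpen
  obtain ⟨δ₁, hδ₁, h₁⟩ := exists_pos_forall_add_smul_mem (hU.mem_nhds hxU) u
  have hcurve : ∀ s, 0 ≤ s → s < δ₁ → ContinuousAt (fun s : ℝ => F (x + s • u)) s := by
    intro s hs hsδ
    have hmem : x + s • u ∈ U := by
      rcases hs.eq_or_lt with rfl | hs
      · simpa using hxU
      · exact h₁ s hs hsδ u (by simpa using hδ₁)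
    exact (hK.continuousOn.continuousAt (hU.mem_nhds hmem)).comp
      (f := fun s : ℝ => x + s • u) (by fun_prop)
  rw [Metric.tendsto_nhds]
  intro η hη
  -- The slopes get `η / 4` and the comparison function `η / 2`: the argument needs a strict gap, as
  -- does the final bound by `η`.
  obtain ⟨δ₂, hδ₂, h₂⟩ := exists_ball_norm_fderiv_sub_le hF hl (ε := η / 4) (by positivity)
  have hseg : ∀ a b, 0 < a → a ≤ b → b < min δ₁ δ₂ →
      ‖F (x + b • u) - F (x + a • u) - (b - a) • l‖ ≤ η / 2 * (b - a) := by
    intro a b ha hab hb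
    rw [lt_min_iff] at hb
    refine image_norm_le_of_liminf_right_slope_norm_lt_deriv_boundary (a := a) (b := b)
      (f := fun s => F (x + s • u) - F (x + a • u) - (s - a) • l) (f' := fun _ => η / 4)
      (B := fun s => η / 2 * (s - a)) (B' := fun _ => η / 2) ?_ ?_ (by simp) (by fun_prop) ?_ ?_
      ⟨hab, le_rfl⟩
    · intro s hs
      exact (((hcurve s (ha.le.trans hs.1) (hs.2.trans_lt hb.1)).sub
        continuousAt_const).sub (by fun_prop)).continuousWithinAt
    · intro s hs c hc
      obtain ⟨r, hr, K', hK', hd⟩ := h₂ s (ha.trans_le hs.1) (hs.2.trans hb.2) u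
        (by simpa using hδ₂)
      have hnear : ∀ᶠ z in 𝓝[>] s, x + z • u ∈ ball (x + s • u) r := by
        have : ContinuousAt (fun z : ℝ => x + z • u) s := by fun_prop
        exact mem_nhdsWithin_of_mem_nhds (this.preimage_mem_nhds (ball_mem_nhds _ hr))
      refine Eventually.frequently ?_
      filter_upwards [hnear, self_mem_nhdsWithin] with z hz hsz
      have hsz : 0 < z - s := sub_pos.2 hsz
      have hstep := norm_sub_sub_smul_le_of_fderiv (s := z - s) (by positivity) isOpen_ball
        (convex_ball _ _) hK' hd hsz.le (mem_ball_self hr)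
        (by rwa [add_assoc, ← add_smul, add_sub_cancel])
      rw [add_assoc, ← add_smul, add_sub_cancel] at hstep
      rw [slope_def_field, div_lt_iff₀ hsz]
      refine lt_of_le_of_lt ?_ (mul_lt_mul_of_pos_right hc hsz)
      refine (norm_sub_norm_le _ _).trans (le_of_eq_of_le (congrArg _ ?_) hstep)
      module
    · intro s _
      simpa using (((hasDerivAt_id s).sub_const a).const_mul (η / 2)).hasDerivWithinAt
    · intro s _ _
      linarith
  have hmin : 0 < min δ₁ δ₂ := lt_min hδ₁ hδ₂
  filter_upwards [Ioo_mem_nhdsGT hmin] with b hb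
  have hlim : ‖F (x + b • u) - F x - b • l‖ ≤ η / 2 * b := by
    have h0 := hcurve 0 le_rfl hδ₁
    have hL : Tendsto (fun a : ℝ => ‖F (x + b • u) - F (x + a • u) - (b - a) • l‖) (𝓝[>] 0)
        (𝓝 ‖F (x + b • u) - F x - b • l‖) := by
      have : ContinuousAt (fun a : ℝ => ‖F (x + b • u) - F (x + a • u) - (b - a) • l‖) 0 :=
        ((continuousAt_const.sub h0).sub (by fun_prop)).norm
      simpa using this.tendsto.mono_left nhdsWithin_le_nhds
    have hR : Tendsto (fun a : ℝ => η / 2 * (b - a)) (𝓝[>] 0) (𝓝 (η / 2 * b)) := by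
      have : ContinuousAt (fun a : ℝ => η / 2 * (b - a)) 0 := by fun_prop
      simpa using this.tendsto.mono_left nhdsWithin_le_nhds
    refine le_of_tendsto_of_tendsto hL hR ?_
    filter_upwards [Ioo_mem_nhdsGT hb.1] with a ha
    exact hseg a b ha.1 ha.2.le hb.2
  have heq : b⁻¹ • (F (x + b • u) - F x) - l = b⁻¹ • (F (x + b • u) - F x - b • l) := by
    rw [smul_sub _ _ (b • l), smul_smul, inv_mul_cancel₀ hb.1.ne', one_smul]
  rw [dist_eq_norm, heq, norm_smul, norm_inv, Real.norm_of_nonneg hb.1.le,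
    inv_mul_lt_iff₀ hb.1]
  nlinarith [hb.1]

end

/-! ### Normals to the graph -/

section

variable {E G : Type*} [NormedAddCommGroup E] [InnerProductSpace ℝ E] [FiniteDimensional ℝ E]
  [NormedAddCommGroup G] [InnerProductSpace ℝ G] [FiniteDimensional ℝ G]
  {F : E → G} {x : E}

/-- The difference quotients of `F` at `y` along `v` stay in a compact ball around `l`; a cluster
point `q₀` makes `(v, q₀)` tangent to the graph. -/
theorem inner_le_of_mem_regularNormalCone_gph {y v : E} {l : G} {ε r : ℝ} {K : NNReal}
    {z : WithLp 2 (E × G)}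
    (hz : z ∈ regularNormalCone (gph fun p => {F p}) (WithLp.toLp 2 (y, F y)))
    (hε : 0 ≤ ε) (hr : 0 < r) (hK : LipschitzOnWith K F (ball y r))
    (hd : ∀ p ∈ ball y r, DifferentiableAt ℝ F p → ‖fderiv ℝ F p v - l‖ ≤ ε) :
    inner ℝ z.fst v + inner ℝ z.snd l ≤ ε * ‖z.snd‖ := by
  -- The `+ 1` covers `v = 0` and keeps the steps strictly inside the ball.
  let c : ℝ := r / (‖v‖ + 1)
  have hc : 0 < c := by positivity
  let s : ℕ → ℝ := fun j => c * (1 / ((j : ℝ) + 1))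
  have hs : ∀ j, 0 < s j := fun j => by positivity
  have hs0 : Tendsto s atTop (𝓝 0) := by
    have := (tendsto_one_div_add_atTop_nhds_zero_nat (𝕜 := ℝ)).const_mul c
    rwa [mul_zero] at this
  have hmem : ∀ j, y + s j • v ∈ ball y r := by
    intro j
    have h1 : s j ≤ c := by
      refine mul_le_of_le_one_right hc.le ?_
      rw [div_le_one (by positivity)]
      linarith [(Nat.cast_nonneg j : (0 : ℝ) ≤ j)]
    rw [mem_ball, dist_eq_norm, add_sub_cancel_left, norm_smul, Real.norm_of_nonneg (hs j).le]
    calc s j * ‖v‖ ≤ c * ‖v‖ := by gcongr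
      _ < c * (‖v‖ + 1) := by gcongr; linarith
      _ = r := div_mul_cancel₀ _ (by positivity)
  let q : ℕ → G := fun j => (s j)⁻¹ • (F (y + s j • v) - F y)
  have hq : ∀ j, q j ∈ closedBall l ε := by
    intro j
    have h1 := norm_sub_sub_smul_le_of_fderiv hε isOpen_ball (convex_ball _ _) hK hd
      (hs j).le (mem_ball_self hr) (hmem j)
    have heq : q j - l = (s j)⁻¹ • (F (y + s j • v) - F y - s j • l) := by
      rw [smul_sub _ _ (s j • l), smul_smul, inv_mul_cancel₀ (hs j).ne', one_smul]
    rwa [mem_closedBall, dist_eq_norm, heq, norm_smul, norm_inv, Real.norm_of_nonneg (hs j).le,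
      inv_mul_le_iff₀ (hs j), mul_comm]
  obtain ⟨q₀, hq₀, φ, hφ, hlim⟩ := (isCompact_closedBall l ε).tendsto_subseq hq
  have htan : WithLp.toLp 2 (v, q₀) ∈
      tangentCone (gph fun p => {F p}) (WithLp.toLp 2 (y, F y)) := by
    refine ⟨s ∘ φ, fun j => WithLp.toLp 2 (v, q (φ j)), fun j => hs _,
      hs0.comp hφ.tendsto_atTop, ?_, fun j => ?_⟩
    · exact ((WithLp.prod_continuous_toLp 2 E G).tendsto _).comp
        (tendsto_const_nhds.prodMk_nhds hlim)
    · change F y + s (φ j) • q (φ j) = F (y + s (φ j) • v)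
      rw [smul_smul, mul_inv_cancel₀ (hs _).ne', one_smul, add_sub_cancel]
  have h1 := hz.2 _ htan
  rw [WithLp.prod_inner_apply] at h1
  change inner ℝ z.fst v + inner ℝ z.snd q₀ ≤ 0 at h1
  have h2 : inner ℝ z.snd (l - q₀) ≤ ‖z.snd‖ * ε := by
    refine (real_inner_le_norm _ _).trans (mul_le_mul_of_nonneg_left ?_ (norm_nonneg _))
    rw [← dist_eq_norm, dist_comm]
    exact hq₀
  rw [inner_sub_right] at h2
  linarith

theorem inner_eq_zero_of_mem_dirLimitingNormalCone_gph {u : E} {l : G} (hF : LipschitzNear F x)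
    (hl : ∀ ε > 0, ∃ δ > 0, ∀ t : ℝ, 0 < t → t < δ → ∀ u' : E, ‖u' - u‖ < δ →
      ∀ A ∈ clarkeJacobian F (x + t • u'), ‖A u' - l‖ < ε)
    {d z : WithLp 2 (E × G)} (hdu : d.fst = u)
    (hz : z ∈ dirLimitingNormalCone (gph fun p => {F p}) (WithLp.toLp 2 (x, F x)) d) :
    inner ℝ z d = 0 := by
  obtain ⟨t, d', z', ht, ht0, hd', hz', hmem⟩ := hz
  have hd₁ : Tendsto (fun k => (d' k).fst) atTop (𝓝 u) :=
    hdu ▸ ((WithLp.prod_continuous_ofLp 2 E G).fst.tendsto d).comp hd'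
  have hd₂ : Tendsto (fun k => (d' k).snd) atTop (𝓝 d.snd) :=
    ((WithLp.prod_continuous_ofLp 2 E G).snd.tendsto d).comp hd'
  have hz₁ : Tendsto (fun k => (z' k).fst) atTop (𝓝 z.fst) :=
    ((WithLp.prod_continuous_ofLp 2 E G).fst.tendsto z).comp hz'
  have hz₂ : Tendsto (fun k => (z' k).snd) atTop (𝓝 z.snd) :=
    ((WithLp.prod_continuous_ofLp 2 E G).snd.tendsto z).comp hz'
  have hgph : ∀ k, F x + t k • (d' k).snd = F (x + t k • (d' k).fst) := fun k => (hmem k).1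
  have hpt : ∀ k, WithLp.toLp 2 (x, F x) + t k • d' k =
      WithLp.toLp 2 (x + t k • (d' k).fst, F (x + t k • (d' k).fst)) := by
    intro k
    rw [← hgph]
    rfl
  -- The sequence lies on the graph, so its second components are difference quotients of `F`.
  have hdl : d.snd = l := by
    refine tendsto_nhds_unique hd₂ ((hF.tendsto_slope_seq
      (tendsto_slope_of_clarkeJacobian hF hl) ht ht0 hd₁).congr fun k => ?_)
    rw [← hgph, add_sub_cancel_left, smul_smul, inv_mul_cancel₀ (ht k).ne', one_smul]
  have hbound : ∀ ε > 0, |inner ℝ z.fst u + inner ℝ z.snd l| ≤ ε * ‖z.snd‖ := by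
    intro ε hε
    obtain ⟨δ, hδ, h⟩ := exists_ball_norm_fderiv_sub_le hF hl hε
    have hL : Tendsto (fun k => |inner ℝ (z' k).fst (d' k).fst + inner ℝ (z' k).snd l|) atTop
        (𝓝 |inner ℝ z.fst u + inner ℝ z.snd l|) :=
      ((hz₁.inner hd₁).add (hz₂.inner tendsto_const_nhds)).abs
    refine le_of_tendsto_of_tendsto hL (hz₂.norm.const_mul ε) ?_
    have hnear : ∀ᶠ k in atTop, ‖(d' k).fst - u‖ < δ :=
      (hd₁.sub_const u).norm.eventually_lt_const (by simpa using hδ)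
    filter_upwards [ht0.eventually_lt_const hδ, hnear] with k hk₁ hk₂
    obtain ⟨r, hr, K, hK, hder⟩ := h (t k) (ht k) hk₁ _ hk₂
    have hn := hmem k
    rw [hpt k] at hn
    have hpos := inner_le_of_mem_regularNormalCone_gph hn hε.le hr hK hder
    -- The derivative estimate is symmetric under `(u', l) ↦ (-u', -l)`, which gives the reverse
    -- inequality.
    have hneg := inner_le_of_mem_regularNormalCone_gph (v := -(d' k).fst) (l := -l)
      hn hε.le hr hK fun p hp hdiff => by
        rw [map_neg, neg_sub_neg, norm_sub_rev]
        exact hder p hp hdiff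
    rw [inner_neg_right, inner_neg_right] at hneg
    exact abs_le.2 ⟨by linarith, hpos⟩
  have hzero : inner ℝ z.fst u + inner ℝ z.snd l = 0 := by
    refine abs_eq_zero.1 (le_antisymm ?_ (abs_nonneg _))
    have hlim : Tendsto (fun ε : ℝ => ε * ‖z.snd‖) (𝓝[>] 0) (𝓝 0) := by
      have : ContinuousAt (fun ε : ℝ => ε * ‖z.snd‖) 0 := by fun_prop
      simpa using this.tendsto.mono_left nhdsWithin_le_nhds
    refine ge_of_tendsto hlim ?_
    filter_upwards [self_mem_nhdsWithin] with ε hε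
    exact hbound ε hε
  rw [WithLp.prod_inner_apply]
  change inner ℝ z.fst d.fst + inner ℝ z.snd d.snd = 0
  rw [hdu, hdl, hzero]

/-- At a point of differentiability, the graph of `F` has normals of the form `(A* w, -w)`. -/
theorem adjoint_mem_regularNormalCone_gph {y : E} (hy : DifferentiableAt ℝ F y) (w : G) :
    WithLp.toLp 2 ((fderiv ℝ F y).adjoint w, -w) ∈
      regularNormalCone (gph fun p => {F p}) (WithLp.toLp 2 (y, F y)) := by
  refine ⟨rfl, ?_⟩
  rintro e ⟨s, d, hs, hs0, hd, hmem⟩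
  have hd₁ : Tendsto (fun k => (d k).fst) atTop (𝓝 e.fst) :=
    ((WithLp.prod_continuous_ofLp 2 E G).fst.tendsto e).comp hd
  have hd₂ : Tendsto (fun k => (d k).snd) atTop (𝓝 e.snd) :=
    ((WithLp.prod_continuous_ofLp 2 E G).snd.tendsto e).comp hd
  have hgph : ∀ k, F y + s k • (d k).snd = F (y + s k • (d k).fst) := hmem
  have hsd : Tendsto (fun k => s k • (d k).fst) atTop (𝓝 0) := by
    simpa using hs0.smul hd₁
  have hcd : Tendsto (fun k => (s k)⁻¹ • s k • (d k).fst) atTop (𝓝 e.fst) :=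
    hd₁.congr fun k => by rw [smul_smul, inv_mul_cancel₀ (hs k).ne', one_smul]
  have hlim := (hy.hasFDerivAt.hasFDerivWithinAt (s := univ)).lim hsd (by simp) hcd
  -- Tangents to the graph lie on the graph of the derivative.
  have heq : fderiv ℝ F y e.fst = e.snd := by
    refine tendsto_nhds_unique (hlim.congr fun k => ?_) hd₂
    rw [← hgph, add_sub_cancel_left, smul_smul, inv_mul_cancel₀ (hs k).ne', one_smul]
  rw [WithLp.prod_inner_apply]
  change inner ℝ ((fderiv ℝ F y).adjoint w) e.fst + inner ℝ (-w) e.snd ≤ 0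
  rw [ContinuousLinearMap.adjoint_inner_left, heq, inner_neg_left, add_neg_cancel]

/-- By contradiction: along a bad sequence the derivatives are bounded by the Lipschitz constant,
hence subconverge to some `A`, and semismoothness* forces `A u = l`. -/
theorem exists_norm_fderiv_sub_lt_of_semismoothStarAt {u : E} {l : G} (hF : LipschitzNear F x)
    (hs : SemismoothStarAt (fun z => {F z}) x (F x))
    (hdir : Tendsto (fun t : ℝ => t⁻¹ • (F (x + t • u) - F x)) (𝓝[>] 0) (𝓝 l))
    {ε : ℝ} (hε : 0 < ε) :
    ∃ δ > 0, ∀ t : ℝ, 0 < t → t < δ → ∀ u' : E, ‖u' - u‖ < δ →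
      DifferentiableAt ℝ F (x + t • u') → ‖fderiv ℝ F (x + t • u') u' - l‖ < ε := by
  obtain ⟨K, U, hU, hxU, hK⟩ := hF.exists_isOpen
  obtain ⟨δ₀, hδ₀, h₀⟩ := exists_pos_forall_add_smul_mem (hU.mem_nhds hxU) u
  by_contra! hcon
  have hδ : ∀ k : ℕ, (0 : ℝ) < min δ₀ (1 / ((k : ℝ) + 1)) := fun k => by positivity
  choose t ht htδ d hd hdiff hge using fun k => hcon _ (hδ k)
  have ht0 : Tendsto t atTop (𝓝 0) :=
    squeeze_zero (fun k => (ht k).le) (fun k => ((htδ k).trans_le (min_le_right _ _)).le)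
      tendsto_one_div_add_atTop_nhds_zero_nat
  have hdu : Tendsto d atTop (𝓝 u) := by
    rw [tendsto_iff_norm_sub_tendsto_zero]
    exact squeeze_zero (fun k => norm_nonneg _) (fun k => ((hd k).trans_le (min_le_right _ _)).le)
      tendsto_one_div_add_atTop_nhds_zero_nat
  have hbdd : ∀ k, fderiv ℝ F (x + t k • d k) ∈ closedBall (0 : E →L[ℝ] G) K := by
    intro k
    rw [mem_closedBall_zero_iff]
    exact norm_fderiv_le_of_lipschitzOn ℝ (hU.mem_nhds (h₀ _ (ht k)
      ((htδ k).trans_le (min_le_left _ _)) _ ((hd k).trans_le (min_le_left _ _)))) hK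
  obtain ⟨A, -, φ, hφ, hA⟩ := (isCompact_closedBall (0 : E →L[ℝ] G) K).tendsto_subseq hbdd
  have htφ := ht0.comp hφ.tendsto_atTop
  have hdφ := hdu.comp hφ.tendsto_atTop
  have hAu : A u = l := by
    refine ext_inner_left ℝ fun w => ?_
    have hzero := hs.2 (WithLp.toLp 2 (u, l)) (WithLp.toLp 2 (A.adjoint w, -w))
      ⟨t ∘ φ, fun k => WithLp.toLp 2 (d (φ k),
          (t (φ k))⁻¹ • (F (x + t (φ k) • d (φ k)) - F x)),
        fun k => WithLp.toLp 2 ((fderiv ℝ F (x + t (φ k) • d (φ k))).adjoint w, -w),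
        fun k => ht _, htφ, ?_, ?_, fun k => ?_⟩
    · rw [WithLp.prod_inner_apply] at hzero
      change inner ℝ (A.adjoint w) u + inner ℝ (-w) l = 0 at hzero
      rw [ContinuousLinearMap.adjoint_inner_left, inner_neg_left] at hzero
      linarith
    · exact ((WithLp.prod_continuous_toLp 2 E G).tendsto _).comp
        (hdφ.prodMk_nhds (hF.tendsto_slope_seq hdir (fun k => ht (φ k)) htφ hdφ))
    · refine ((WithLp.prod_continuous_toLp 2 E G).tendsto _).comp
        (Tendsto.prodMk_nhds ?_ tendsto_const_nhds)
      have hadj : Continuous fun B : E →L[ℝ] G => B.adjoint w :=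
        (ContinuousLinearMap.adjoint.continuous).clm_apply continuous_const
      exact (hadj.tendsto A).comp hA
    · change _ ∈ regularNormalCone _ (WithLp.toLp 2 (x + t (φ k) • d (φ k),
        F x + t (φ k) • (t (φ k))⁻¹ • (F (x + t (φ k) • d (φ k)) - F x)))
      rw [smul_smul, mul_inv_cancel₀ (ht _).ne', one_smul, add_sub_cancel]
      exact adjoint_mem_regularNormalCone_gph (hdiff (φ k)) w
  have hlim : Tendsto (fun k => ‖fderiv ℝ F (x + t (φ k) • d (φ k)) (d (φ k)) - l‖) atTop
      (𝓝 0) := by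
    have := ((isBoundedBilinearMap_apply.continuous.tendsto (A, u)).comp
      (hA.prodMk_nhds hdφ)).sub_const l |>.norm
    rwa [hAu, sub_self, norm_zero] at this
  obtain ⟨k, hk⟩ := (hlim.eventually_lt_const hε).exists
  exact (hge (φ k)).not_gt hk

theorem semismoothAt_iff (hF : LipschitzNear F x) :
    SemismoothAt F x ↔
      (SemismoothStarAt (fun z => {F z}) x (F x) ∧ DirectionallyDifferentiableAt F x) := by
  constructor
  · rintro ⟨-, h⟩
    refine ⟨⟨rfl, fun d z hz => ?_⟩, fun u => ?_⟩
    · obtain ⟨l, hl⟩ := h d.fst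
      exact inner_eq_zero_of_mem_dirLimitingNormalCone_gph hF hl rfl hz
    · obtain ⟨l, hl⟩ := h u
      exact ⟨l, tendsto_slope_of_clarkeJacobian hF hl⟩
  · rintro ⟨hs, hdir⟩
    refine ⟨hF, fun u => ?_⟩
    obtain ⟨l, hl⟩ := hdir u
    refine ⟨l, fun ε hε => ?_⟩
    -- Halving `ε` restores the strict inequality lost in the closure.
    obtain ⟨δ, hδ, h⟩ := exists_norm_fderiv_sub_lt_of_semismoothStarAt hF hs hl (half_pos hε)
    exact ⟨δ, hδ, fun t ht htδ u' hu' A hA =>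
      (norm_clarkeJacobian_sub_le h ht htδ hu' hA).trans_lt (half_lt_self hε)⟩

end

end VarAnalysis

theorem mainTheorem9 (n m : ℕ)
    (F : EuclideanSpace ℝ (Fin n) → EuclideanSpace ℝ (Fin m)) (x : EuclideanSpace ℝ (Fin n))
    (hF : VarAnalysis.LipschitzNear F x) :
    VarAnalysis.SemismoothAt F x ↔
      (VarAnalysis.SemismoothStarAt (fun z => {F z}) x (F x) ∧
        VarAnalysis.DirectionallyDifferentiableAt F x) :=
  VarAnalysis.semismoothAt_iff hF
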